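/- Fix an integer $q\ge 2$ and let $T$ be the $q$-valent rooted tree: its vertices are the finite sequences from $\{0,\dots,q-1\}$ and its directed edges are the pairs $(w,wi)$. For a vertex $a$ of a digraph $D$, let $\operatorname{desc}(a)$ be the set of vertices reachable from $a$ by a directed path (of length $\ge 0$), and for a set $X$ of vertices let $\operatorname{desc}(X)=\bigcup_{x\in X}\operatorname{desc}(x)$. Sets of vertices are regarded as full induced subdigraphs. A subdigraph $A$ of $D$ is descendant-closed if $\operatorname{desc}(a)\subseteq A$ for all $a\in A$, and finitely generated if $A=\operatorname{desc}(X)$ for some finite set $X$ of vertices. The digraph $D$ is descendant-homogeneous if every isomorphism between finitely generated descendant-closed subdigraphs of $D$ extends to an automorphism of $D$. Let $\mathcal C=\mathcal C_\infty$ be the class of finitely generated digraphs $A$ such that $\operatorname{desc}(a)\cong T$ and $\operatorname{desc}(a)\cap\operatorname{desc}(b)$ is finitely generated for all vertices $a,b$ of $A$. For an integer $n\ge 2$, let $\mathcal T_n\in\mathcal C$ be the digraph obtained from $T$ by replacing the root by $n$ root vertices, all with the same out-neighbours, and let $\mathcal C_n$ be the class of those $A\in\mathcal C$ in which $\mathcal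 T_n$ does not embed as a descendant-closed (full induced) subdigraph. For $n\in\{2,3,\dots,\infty\}$, the Fraïssé limit $D_n$ of $\mathcal C_n$ is the countable descendant-homogeneous digraph, determined up to isomorphism, for which the class of digraphs isomorphic to its finitely generated descendant-closed subdigraphs is exactly $\mathcal C_n$. **Theorem.** Let $D$ be a non-empty countable descendant-homogeneous digraph in which $\operatorname{desc}(a)\cong T$ for every vertex $a$. Then $D\cong D_n$ for some $n\in\{2,3,\dots,\infty\}$; that is, for some such $n$, the digraph $D$ is a Fraïssé limit of $\mathcal C_n$, and every Fraïssé limit of $\mathcal C_n$ is isomorphic to $D$. -/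

import Mathlib

universe u v

namespace DescDigraph

/-- Isomorphisms of digraphs: bijections preserving and reflecting directed edges. -/
abbrev Iso {V : Type*} {W : Type*} (D : Digraph V) (E : Digraph W) : Type _ :=
  D.Adj ≃r E.Adj

/-- Embeddings of digraphs (always as full induced subdigraphs). -/
abbrev Embedding {V : Type*} {W : Type*} (D : Digraph V) (E : Digraph W) : Type _ :=
  D.Adj ↪r E.Adj

/-- The full induced subdigraph of `D` on the set `S` of vertices. -/
def induce {V : Type*} (D : Digraph V) (S : Set V) : Digraph S where
  Adj a b := D.Adj a b

/-- The descendant set of the vertex `a`: all vertices that can be reached from `a` by a directed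
path of length `≥ 0`. (A shortest path from `a` never backtracks, so the same set is obtained from
paths `u₀ u₁ … uₛ` with the extra requirement `uᵢ₋₁ ≠ uᵢ₊₁`.) -/
def desc {V : Type*} (D : Digraph V) (a : V) : Set V :=
  {b | Relation.ReflTransGen D.Adj a b}

/-- The descendant set of a set of vertices. -/
def descSet {V : Type*} (D : Digraph V) (X : Set V) : Set V :=
  ⋃ x ∈ X, desc D x

/-- `S ≤ D`: the set `S` of vertices is descendant-closed in `D`. -/
def DescClosed {V : Type*} (D : Digraph V) (S : Set V) : Prop :=
  ∀ a ∈ S, desc D a ⊆ S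

/-- `S` is (the vertex set of) a finitely generated descendant-closed subdigraph of `D`: it is the
descendant set of a finite, possibly empty, set of vertices. -/
def FinGen {V : Type*} (D : Digraph V) (S : Set V) : Prop :=
  ∃ X : Set V, X.Finite ∧ S = descSet D X

/-- `D` is descendant-homogeneous: every isomorphism between finitely generated descendant-closed
subdigraphs of `D` extends to an automorphism of `D`. -/
def DescHomogeneous {V : Type*} (D : Digraph V) : Prop :=
  ∀ A₁ A₂ : Set V, FinGen D A₁ → FinGen D A₂ →
    ∀ f : Iso (induce D A₁) (induce D A₂),
      ∃ g : Iso D D, ∀ a : A₁, g (a : V) = (f a : V)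

/-- The digraph `E` embeds in `D` as a descendant-closed subdigraph. -/
def DescEmbeds {V : Type*} {W : Type*} (E : Digraph W) (D : Digraph V) : Prop :=
  ∃ f : Embedding E D, DescClosed D (Set.range f)

/-- The `q`-valent rooted tree `T`: vertices are the finite sequences from `{0, …, q - 1}` and the
edges are the pairs `(w, wi)`. -/
def tree (q : ℕ) : Digraph (List (Fin q)) where
  Adj w w' := ∃ i : Fin q, w' = w ++ [i]

/-- All descendant sets of single vertices of `D`, as induced subdigraphs, are isomorphic to the
`q`-valent rooted tree. -/
def HasTreeDesc (q : ℕ) {V : Type*} (D : Digraph V) : Prop :=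
  ∀ a : V, Nonempty (Iso (induce D (desc D a)) (tree q))

/-- The digraph `𝒯ₙ`: the `q`-valent rooted tree with its root replaced by `n` root vertices, all
having the same out-neighbours. -/
def multiTree (q n : ℕ) : Digraph (Fin n ⊕ {w : List (Fin q) // w ≠ []}) where
  Adj
    | Sum.inl _, Sum.inr w => (tree q).Adj [] w.1
    | Sum.inr w, Sum.inr w' => (tree q).Adj w.1 w'.1
    | _, Sum.inl _ => False

/-- The class `𝒞` (of digraphs with vertex set in a given universe): finitely generated digraphs in
which all descendant sets of vertices are isomorphic to the `q`-valent rooted tree, and the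
descendant sets of any two vertices have finitely generated intersection. -/
def ClassC (q : ℕ) (V : Type u) (A : Digraph V) : Prop :=
  HasTreeDesc q A ∧ FinGen A Set.univ ∧ ∀ a b : V, FinGen A (desc A a ∩ desc A b)

/-- The class `𝒞ₙ` for `n ∈ {2, 3, …, ∞}`: for finite `n`, the digraphs in `𝒞` in which `𝒯ₙ` does
not embed as a descendant-closed subdigraph; for `n = ∞`, all of `𝒞`. -/
def ClassCn (q : ℕ) (n : ℕ∞) (V : Type u) (A : Digraph V) : Prop :=
  ClassC q V A ∧ ∀ m : ℕ, n = (m : ℕ∞) → ¬ DescEmbeds (multiTree q m) A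

/-- `M` is a Fraïssé limit of the class `K` with respect to `≤`: `M` is a countable
descendant-homogeneous digraph, and the digraphs in `K` are exactly the digraphs that are isomorphic
to finitely generated descendant-closed subdigraphs of `M`. -/
def IsFraisseLimit (K : ∀ W : Type u, Digraph W → Prop) {V : Type u} (M : Digraph V) : Prop :=
  Countable V ∧ DescHomogeneous M ∧
    ∀ (W : Type u) (A : Digraph W),
      K W A ↔ ∃ S : Set V, FinGen M S ∧ Nonempty (Iso A (induce M S))

end DescDigraph

/-! Call vertices twins when they have the same out-neighbours. Mapping one descendant tree onto
another and extending shows that `D` is vertex-transitive, so all vertices have the same number t of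
twins, themselves included. Take n = t + 1: for finite n, `𝒯ₙ` is absent exactly when twin classes
have fewer than n members.

The delicate point is that desc(a) ∩ desc(b) is finitely generated (`DescHomogeneous.finGen_inter`).
The ends of the tree desc(b) that eventually lie in desc(a) form an open subset U_a of the compact
space of sequences. Translations of the tree act transitively on ends and extend to automorphisms of
`D`, so each translate of U_a is again some U_v. There are countably many v, so by Baire some end
avoids every frontier. Moving a frontier point of U_a to that end is impossible, hence U_a is
clopen, and compactness bounds the length of the generators.

Consequently finitely generated sets grow by two moves only: adding a disjoint tree, or adding a
vertex whose out-neighbours are present (`Sparse.desc_induction`). Homogeneity and the twin count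
realise both moves in `D` (`Rich.exists_disjoint`, `Rich.exists_parent`), which gives the extension
property `Rich.exists_extend`. It embeds all of `𝒞ₙ` in `D`, and back-and-forth identifies `D` with
any other limit, which is rich as well (`Rich.of_isFraisseLimit`). -/

namespace DescDigraph

open Set

/-! ### Descendant-closed sets and partial embeddings -/

section Basic

variable {V W X : Type*} {D : Digraph V} {E : Digraph W} {F : Digraph X}

/-- The set of out-neighbours of a vertex. -/
def out (D : Digraph V) (a : V) : Set V :=
  {b | D.Adj a b}

theorem mem_desc_self (D : Digraph V) (a : V) : a ∈ desc D a := Relation.ReflTransGen.refl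

theorem desc_subset_of_mem {a b : V} (h : b ∈ desc D a) : desc D b ⊆ desc D a :=
  fun _ hc => Relation.ReflTransGen.trans h hc

theorem out_subset_desc (D : Digraph V) (a : V) : out D a ⊆ desc D a :=
  fun _ hb => Relation.ReflTransGen.single hb

theorem descClosed_iff {B : Set V} : DescClosed D B ↔ ∀ a ∈ B, out D a ⊆ B := by
  constructor
  · intro h a ha
    exact (out_subset_desc D a).trans (h a ha)
  · intro h a ha b hb
    induction hb with
    | refl => exact ha
    | tail _ hbc ih => exact h _ ih hbc

theorem DescClosed.out_subset {B : Set V} (h : DescClosed D B) {a : V} (ha : a ∈ B) :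
    out D a ⊆ B := descClosed_iff.1 h a ha

theorem descClosed_desc (D : Digraph V) (a : V) : DescClosed D (desc D a) :=
  fun _ hb => desc_subset_of_mem hb

theorem descClosed_univ (D : Digraph V) : DescClosed D univ := fun _ _ => subset_univ _

theorem descClosed_descSet (D : Digraph V) (Y : Set V) : DescClosed D (descSet D Y) := by
  intro a ha
  obtain ⟨y, hy, hay⟩ := mem_iUnion₂.1 ha
  exact (desc_subset_of_mem hay).trans (subset_biUnion_of_mem (u := fun x => desc D x) hy)

theorem DescClosed.descSet_subset {B Y : Set V} (hB : DescClosed D B) (h : Y ⊆ B) :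
    descSet D Y ⊆ B := iUnion₂_subset fun y hy => hB y (h hy)

theorem subset_descSet (D : Digraph V) (Y : Set V) : Y ⊆ descSet D Y :=
  fun y hy => mem_iUnion₂.2 ⟨y, hy, mem_desc_self D y⟩

theorem descSet_union (D : Digraph V) (Y Z : Set V) :
    descSet D (Y ∪ Z) = descSet D Y ∪ descSet D Z := biUnion_union _ _ _

theorem descSet_insert (D : Digraph V) (y : V) (Z : Set V) :
    descSet D (insert y Z) = desc D y ∪ descSet D Z := biUnion_insert _ _ _

theorem desc_eq_insert (D : Digraph V) (a : V) : desc D a = insert a (descSet D (out D a)) := by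
  ext b
  constructor
  · intro h
    rcases Relation.ReflTransGen.cases_head h with rfl | ⟨c, hac, hcb⟩
    · exact mem_insert _ _
    · exact mem_insert_of_mem _ (mem_iUnion₂.2 ⟨c, hac, hcb⟩)
  · rintro (rfl | h)
    · exact mem_desc_self D b
    · exact (descClosed_desc D a).descSet_subset (out_subset_desc D a) h

theorem FinGen.descClosed {B : Set V} (h : FinGen D B) : DescClosed D B := by
  obtain ⟨Y, -, rfl⟩ := h
  exact descClosed_descSet D Y

theorem finGen_descSet {Y : Set V} (h : Y.Finite) : FinGen D (descSet D Y) := ⟨Y, h, rfl⟩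

theorem finGen_desc (D : Digraph V) (a : V) : FinGen D (desc D a) :=
  ⟨{a}, finite_singleton a, (biUnion_singleton a _).symm⟩

theorem finGen_empty (D : Digraph V) : FinGen D ∅ := ⟨∅, finite_empty, (biUnion_empty _).symm⟩

theorem FinGen.union {B C : Set V} (hB : FinGen D B) (hC : FinGen D C) : FinGen D (B ∪ C) := by
  obtain ⟨Y, hY, rfl⟩ := hB
  obtain ⟨Z, hZ, rfl⟩ := hC
  exact ⟨Y ∪ Z, hY.union hZ, (descSet_union D Y Z).symm⟩

theorem finGen_biUnion {ι : Type*} (s : Set ι) (hs : s.Finite) (B : ι → Set V)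
    (h : ∀ i ∈ s, FinGen D (B i)) : FinGen D (⋃ i ∈ s, B i) := by
  induction s, hs using Set.Finite.induction_on with
  | empty => simpa using finGen_empty D
  | insert _ _ ih =>
    rw [biUnion_insert]
    exact (h _ (mem_insert _ _)).union (ih fun i hi => h i (mem_insert_of_mem _ hi))

/-- `f` restricts to an embedding of the set `B` of vertices of `D` into `E` that preserves
out-neighbourhoods. When `B` is descendant-closed, this says that `f` embeds the subdigraph `B`
as a descendant-closed subdigraph of `E`. -/
structure EmbOn (D : Digraph V) (E : Digraph W) (B : Set V) (f : V → W) : Prop where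
  injOn : InjOn f B
  out_eq : ∀ a ∈ B, out E (f a) = f '' out D a

namespace EmbOn

variable {B C : Set V} {f g : V → W}

theorem mono (h : EmbOn D E B f) (hC : C ⊆ B) : EmbOn D E C f :=
  ⟨h.injOn.mono hC, fun a ha => h.out_eq a (hC ha)⟩

theorem congr (h : EmbOn D E B f) (hB : DescClosed D B) (hfg : EqOn f g B) : EmbOn D E B g := by
  refine ⟨h.injOn.congr hfg, fun a ha => ?_⟩
  rw [← hfg ha, h.out_eq a ha]
  exact image_congr (hfg.mono (hB.out_subset ha))

theorem comp {C : Set W} {g : W → X} (hg : EmbOn E F C g) (hf : EmbOn D E B f)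
    (hm : MapsTo f B C) : EmbOn D F B (g ∘ f) := by
  refine ⟨hg.injOn.comp hf.injOn hm, fun a ha => ?_⟩
  rw [Function.comp_apply, hg.out_eq _ (hm ha), hf.out_eq a ha, image_comp]

theorem image_desc (h : EmbOn D E B f) (hB : DescClosed D B) {a : V} (ha : a ∈ B) :
    desc E (f a) = f '' desc D a := by
  apply Subset.antisymm
  · intro b hb
    induction hb with
    | refl => exact mem_image_of_mem f (mem_desc_self D a)
    | tail _ hbc ih =>
      obtain ⟨x, hx, rfl⟩ := ih
      have hxB := hB a ha hx
      have : _ ∈ out E (f x) := hbc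
      rw [h.out_eq x hxB] at this
      obtain ⟨y, hy, rfl⟩ := this
      exact mem_image_of_mem f (Relation.ReflTransGen.tail hx hy)
  · rintro _ ⟨b, hb, rfl⟩
    induction hb with
    | refl => exact mem_desc_self E _
    | tail hab hbc ih =>
      refine Relation.ReflTransGen.tail ih ?_
      change _ ∈ out E _
      rw [h.out_eq _ (hB a ha hab)]
      exact mem_image_of_mem f hbc

theorem image_descSet (h : EmbOn D E B f) (hB : DescClosed D B) {Y : Set V} (hY : Y ⊆ B) :
    descSet E (f '' Y) = f '' descSet D Y := by
  rw [descSet, descSet, biUnion_image, image_iUnion₂]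
  exact iUnion₂_congr fun y hy => h.image_desc hB (hY hy)

theorem descClosed_image (h : EmbOn D E B f) (hB : DescClosed D B) : DescClosed E (f '' B) := by
  rintro _ ⟨a, ha, rfl⟩
  rw [h.image_desc hB ha]
  exact image_mono (hB a ha)

theorem finGen_image (h : EmbOn D E B f) (hB : DescClosed D B) (hC : FinGen D C) (hCB : C ⊆ B) :
    FinGen E (f '' C) := by
  obtain ⟨Y, hY, rfl⟩ := hC
  exact ⟨f '' Y, hY.image f, (h.image_descSet hB ((subset_descSet D Y).trans hCB)).symm⟩

theorem adj_iff (h : EmbOn D E B f) (hB : DescClosed D B) {a b : V} (ha : a ∈ B) (hb : b ∈ B) :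
    E.Adj (f a) (f b) ↔ D.Adj a b := by
  change f b ∈ out E (f a) ↔ b ∈ out D a
  rw [h.out_eq a ha, h.injOn.mem_image_iff (hB.out_subset ha) hb]

theorem invFunOn [Nonempty V] (h : EmbOn D E B f) (hB : DescClosed D B) :
    EmbOn E D (f '' B) (Function.invFunOn f B) := by
  have hl : ∀ a ∈ B, Function.invFunOn f B (f a) = a := fun a ha => h.injOn.leftInvOn_invFunOn ha
  refine ⟨?_, ?_⟩
  · rintro _ ⟨a, ha, rfl⟩ _ ⟨b, hb, rfl⟩ hab
    rw [hl a ha, hl b hb] at hab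
    rw [hab]
  · rintro _ ⟨a, ha, rfl⟩
    rw [hl a ha, h.out_eq a ha, image_image]
    conv_lhs => rw [← image_id (out D a)]
    exact image_congr fun x hx => (hl x (hB.out_subset ha hx)).symm

/-- Embeddings of two disjoint subdigraphs with disjoint images can be glued. -/
theorem exists_union (hf : EmbOn D E B f) (hg : EmbOn D E C g) (hB : DescClosed D B)
    (hC : DescClosed D C) (hBC : Disjoint B C) (him : Disjoint (f '' B) (g '' C)) :
    ∃ k, EmbOn D E (B ∪ C) k ∧ EqOn f k B ∧ EqOn g k C := by
  classical
  refine ⟨B.piecewise f g, ⟨?_, ?_⟩, ?_⟩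
  rotate_right
  · exact ⟨(piecewise_eqOn B f g).symm,
      (piecewise_eqOn_compl B f g).symm.mono hBC.subset_compl_left⟩
  all_goals
    have e1 : EqOn f (B.piecewise f g) B := (piecewise_eqOn B f g).symm
    have e2 : EqOn g (B.piecewise f g) C :=
      (piecewise_eqOn_compl B f g).symm.mono hBC.subset_compl_left
    have h1 := hf.congr hB e1
    have h2 := hg.congr hC e2
  · refine (injOn_union hBC).2 ⟨h1.injOn, h2.injOn, fun a ha b hb hab => ?_⟩
    rw [← e1 ha, ← e2 hb] at hab
    exact disjoint_left.1 him (mem_image_of_mem f ha) (hab ▸ mem_image_of_mem g hb)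
  · rintro a (ha | ha)
    · exact h1.out_eq a ha
    · exact h2.out_eq a ha

/-- An embedding can be extended to a new vertex all of whose out-neighbours are in its domain. -/
theorem exists_insert (hf : EmbOn D E B f) (hB : DescClosed D B) {w : V} {w' : W}
    (hw : w ∉ B) (hout : out D w ⊆ B) (hw' : w' ∉ f '' B) (hout' : out E w' = f '' out D w) :
    ∃ k, EmbOn D E (insert w B) k ∧ EqOn f k B ∧ k w = w' := by
  classical
  have e : EqOn f (Function.update f w w') B := fun a ha =>
    (Function.update_of_ne (ne_of_mem_of_not_mem ha hw) _ _).symm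
  have h1 := hf.congr hB e
  refine ⟨Function.update f w w', ⟨?_, ?_⟩, e, Function.update_self ..⟩
  · refine (injOn_insert hw).2 ⟨h1.injOn, ?_⟩
    rwa [Function.update_self, ← image_congr e]
  · rintro a (rfl | ha)
    · rw [Function.update_self, hout']
      exact image_congr (e.mono hout)
    · exact h1.out_eq a ha

/-- The isomorphism between the domain and the image of an embedding. -/
noncomputable def iso (h : EmbOn D E B f) (hB : DescClosed D B) :
    Iso (induce D B) (induce E (f '' B)) where
  toEquiv := h.injOn.bijOn_image.equiv f
  map_rel_iff' {a b} := h.adj_iff hB a.2 b.2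

/-- The isomorphism between the domain and the range of an embedding. -/
noncomputable def isoRange (h : EmbOn D E univ f) : Iso D (induce E (range f)) where
  toEquiv := Equiv.ofInjective f (injOn_univ.1 h.injOn)
  map_rel_iff' {a b} := h.adj_iff (descClosed_univ D) (mem_univ a) (mem_univ b)

theorem exists_iso (h : EmbOn D E univ f) (hs : Function.Surjective f) :
    ∃ g : Iso D E, ∀ a, g a = f a :=
  ⟨⟨Equiv.ofBijective f ⟨injOn_univ.1 h.injOn, hs⟩,
    fun {a b} => h.adj_iff (descClosed_univ D) (mem_univ a) (mem_univ b)⟩, fun _ => rfl⟩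

end EmbOn

theorem Iso.embOn (g : Iso D E) : EmbOn D E univ g := by
  refine ⟨g.injective.injOn, fun a _ => ?_⟩
  ext b
  obtain ⟨b, rfl⟩ := g.surjective b
  rw [g.injective.mem_set_image]
  exact g.map_rel_iff

theorem embOn_val {S : Set V} (hS : DescClosed D S) :
    EmbOn (induce D S) D univ (Subtype.val : S → V) := by
  refine ⟨Subtype.val_injective.injOn, fun a _ => ?_⟩
  ext b
  constructor
  · intro h
    exact ⟨⟨b, hS.out_subset a.2 h⟩, h, rfl⟩
  · rintro ⟨b, h, rfl⟩
    exact h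

theorem Embedding.embOn (f : Embedding D E) (hf : DescClosed E (range f)) :
    EmbOn D E univ f := by
  refine ⟨f.injective.injOn, fun a _ => ?_⟩
  ext b
  constructor
  · intro h
    obtain ⟨c, rfl⟩ := hf.out_subset (mem_range_self a) h
    exact mem_image_of_mem _ (f.map_rel_iff.1 h)
  · rintro ⟨c, h, rfl⟩
    exact f.map_rel_iff.2 h

theorem EmbOn.descEmbeds {f : V → W} (h : EmbOn D E univ f) : DescEmbeds D E := by
  refine ⟨⟨⟨f, injOn_univ.1 h.injOn⟩,
    h.adj_iff (descClosed_univ D) (mem_univ _) (mem_univ _)⟩, ?_⟩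
  have := h.descClosed_image (descClosed_univ D)
  rwa [image_univ] at this

theorem DescHomogeneous.exists_extend (hD : DescHomogeneous D) {B : Set V} (hB : FinGen D B)
    {f : V → V} (hf : EmbOn D D B f) : ∃ g : Iso D D, EqOn g f B := by
  obtain ⟨g, hg⟩ := hD B (f '' B) hB (hf.finGen_image hB.descClosed hB subset_rfl)
    (hf.iso hB.descClosed)
  exact ⟨g, fun a ha => hg ⟨a, ha⟩⟩

theorem finGen_image_iff {f : V → W} (h : EmbOn D E univ f) {C : Set V} :
    FinGen E (f '' C) ↔ FinGen D C := by
  refine ⟨?_, fun hC => h.finGen_image (descClosed_univ D) hC (subset_univ C)⟩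
  rintro ⟨Y, hY, hC⟩
  have hYC : Y ⊆ f '' C := hC ▸ subset_descSet E Y
  obtain ⟨Z, -, rfl⟩ := subset_image_iff.1 hYC
  refine ⟨Z, hY.of_finite_image (h.injOn.mono (subset_univ Z)), ?_⟩
  rw [h.image_descSet (descClosed_univ D) (subset_univ Z)] at hC
  exact (injOn_univ.1 h.injOn).image_injective hC

end Basic

/-! ### The rooted tree and its copies inside a digraph -/

section Tree

variable {V W : Type*} {D : Digraph V} {E : Digraph W} {q : ℕ}

theorem out_tree (w : List (Fin q)) : out (tree q) w = range fun i => w ++ [i] := by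
  ext x
  simp [out, tree, eq_comm]

theorem desc_tree (w : List (Fin q)) : desc (tree q) w = {x | w <+: x} := by
  apply Subset.antisymm
  · intro x hx
    induction hx with
    | refl => exact List.prefix_refl w
    | tail _ hbc ih =>
      obtain ⟨i, rfl⟩ := hbc
      exact List.IsPrefix.trans ih (List.prefix_append _ _)
  · rintro _ ⟨x, rfl⟩
    induction x using List.reverseRecOn with
    | nil => simpa using mem_desc_self _ w
    | append_singleton x i ih =>
      exact Relation.ReflTransGen.tail ih ⟨i, (List.append_assoc _ _ _).symm⟩

theorem desc_tree_nil : desc (tree q) [] = univ := by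
  rw [desc_tree]
  exact eq_univ_of_forall fun x => List.nil_prefix

theorem HasTreeDesc.exists_embOn (h : HasTreeDesc q D) (a : V) :
    ∃ e : List (Fin q) → V, EmbOn (tree q) D univ e ∧ e [] = a := by
  obtain ⟨g⟩ := h a
  have hg := (embOn_val (descClosed_desc D a)).comp (Iso.embOn g.symm) (mapsTo_univ _ _)
  refine ⟨_, hg, ?_⟩
  -- The given isomorphism is not assumed to match roots. It must: `[]` is a descendant of the word
  -- sent to `a`, so that word is a prefix of `[]`.
  have hmem : (g.symm [] : V) ∈ desc D a := (g.symm []).2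
  obtain ⟨w, hw⟩ := g.symm.surjective ⟨a, mem_desc_self D a⟩
  have hw' : (Subtype.val ∘ g.symm) w = a := congrArg Subtype.val hw
  have h1 := hg.image_desc (descClosed_univ _) (mem_univ w)
  rw [hw'] at h1
  obtain ⟨x, hx, hxe⟩ := h1.subset hmem
  obtain rfl : x = [] := g.symm.injective (Subtype.ext hxe)
  rw [desc_tree] at hx
  obtain rfl := List.prefix_nil.1 hx
  exact hw'

theorem EmbOn.range_tree {e : List (Fin q) → V} (h : EmbOn (tree q) D univ e) :
    range e = desc D (e []) := by
  rw [h.image_desc (descClosed_univ _) (mem_univ _), desc_tree_nil, image_univ]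

theorem EmbOn.desc_tree {e : List (Fin q) → V} (h : EmbOn (tree q) D univ e) (w : List (Fin q)) :
    desc D (e w) = e '' {x | w <+: x} := by
  rw [h.image_desc (descClosed_univ _) (mem_univ _), DescDigraph.desc_tree]

theorem EmbOn.out_tree {e : List (Fin q) → V} (h : EmbOn (tree q) D univ e) (w : List (Fin q)) :
    out D (e w) = range fun i => e (w ++ [i]) := by
  rw [h.out_eq _ (mem_univ _), DescDigraph.out_tree, ← range_comp]
  rfl

theorem EmbOn.injective {f : V → W} (h : EmbOn D E univ f) : Function.Injective f :=
  injOn_univ.1 h.injOn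

theorem hasTreeDesc_of_embOn
    (h : ∀ a, ∃ e : List (Fin q) → V, EmbOn (tree q) D univ e ∧ e [] = a) : HasTreeDesc q D := by
  intro a
  obtain ⟨e, he, rfl⟩ := h a
  rw [← he.range_tree]
  exact ⟨he.isoRange.symm⟩

theorem HasTreeDesc.of_embOn {f : V → W} (hE : HasTreeDesc q E) (h : EmbOn D E univ f) :
    HasTreeDesc q D := by
  refine hasTreeDesc_of_embOn fun a => ?_
  have : Nonempty V := ⟨a⟩
  obtain ⟨e, he, hea⟩ := hE.exists_embOn (f a)
  refine ⟨_, (h.invFunOn (descClosed_univ D)).comp he fun w _ => ?_, ?_⟩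
  · have : e w ∈ range e := mem_range_self w
    rw [he.range_tree, hea, h.image_desc (descClosed_univ D) (mem_univ a)] at this
    exact image_mono (subset_univ _) this
  · simp only [Function.comp_apply, hea]
    exact h.injOn.leftInvOn_invFunOn (mem_univ a)

theorem exists_embOn_desc (hD : HasTreeDesc q D) (hE : HasTreeDesc q E) (a : V) (b : W) :
    ∃ f, EmbOn D E (desc D a) f ∧ f a = b := by
  obtain ⟨d, hd, rfl⟩ := hD.exists_embOn a
  obtain ⟨e, he, rfl⟩ := hE.exists_embOn b
  have h1 := hd.invFunOn (descClosed_univ _)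
  rw [image_univ, hd.range_tree] at h1
  refine ⟨_, he.comp h1 (mapsTo_univ _ _), ?_⟩
  simp only [Function.comp_apply]
  rw [hd.injOn.leftInvOn_invFunOn (mem_univ [])]

namespace HasTreeDesc

theorem finite_out (h : HasTreeDesc q D) (a : V) : (out D a).Finite := by
  obtain ⟨e, he, rfl⟩ := h.exists_embOn a
  rw [he.out_tree]
  exact finite_range _

theorem not_mem_descSet_out (h : HasTreeDesc q D) (a : V) : a ∉ descSet D (out D a) := by
  obtain ⟨e, he, rfl⟩ := h.exists_embOn a
  intro hmem
  obtain ⟨c, hc, hac⟩ := mem_iUnion₂.1 hmem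
  rw [he.out_tree] at hc
  obtain ⟨i, rfl⟩ := hc
  rw [he.desc_tree, he.injective.mem_set_image] at hac
  simp at hac

theorem disjoint_children {e : List (Fin q) → V} (he : EmbOn (tree q) D univ e)
    (w : List (Fin q)) {i j : Fin q} (hij : i ≠ j) :
    Disjoint (desc D (e (w ++ [i]))) (desc D (e (w ++ [j]))) := by
  rw [he.desc_tree, he.desc_tree, disjoint_image_iff he.injective, disjoint_left]
  intro x hx hy
  have := (List.prefix_of_prefix_length_le hx hy (by simp)).eq_of_length (by simp)
  simp at this
  exact hij this

theorem exists_disjoint_children (h : HasTreeDesc q D) (hq : 2 ≤ q) (a : V) :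
    ∃ b ∈ desc D a, ∃ c ∈ desc D a, Disjoint (desc D b) (desc D c) := by
  obtain ⟨e, he, rfl⟩ := h.exists_embOn a
  have hr := he.range_tree
  have hne : (⟨0, by omega⟩ : Fin q) ≠ ⟨1, by omega⟩ := by simp
  exact ⟨_, hr ▸ mem_range_self _, _, hr ▸ mem_range_self _, disjoint_children he [] hne⟩

theorem eq_of_out_eq (h : HasTreeDesc q D) (hq : 2 ≤ q) {x a b : V} (ha : a ∈ desc D x)
    (hb : b ∈ desc D x) (hab : out D a = out D b) : a = b := by
  obtain ⟨e, he, rfl⟩ := h.exists_embOn x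
  rw [← he.range_tree] at ha hb
  obtain ⟨s, rfl⟩ := ha
  obtain ⟨t, rfl⟩ := hb
  rw [he.out_tree, he.out_tree] at hab
  -- One common child suffices, since deleting the last letter of a word recovers its parent.
  obtain ⟨j, hj⟩ := hab ▸ mem_range_self (f := fun i => e (s ++ [i])) (⟨0, by omega⟩ : Fin q)
  have := List.append_inj_left' (he.injective hj) rfl
  rw [this]

end HasTreeDesc

end Tree

/-! ### Ends of the tree as a compact space -/

section Ends

variable {q : ℕ}

/-- The finite initial segments of an infinite sequence, that is, the vertices on an infinite
directed path of the tree that starts at the root. -/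
def initSeg (x : ℕ → Fin q) (k : ℕ) : List (Fin q) := (List.range k).map x

theorem initSeg_succ (x : ℕ → Fin q) (k : ℕ) : initSeg x (k + 1) = initSeg x k ++ [x k] := by
  simp [initSeg, List.range_succ]

@[simp] theorem length_initSeg (x : ℕ → Fin q) (k : ℕ) : (initSeg x k).length = k := by
  simp [initSeg]

theorem initSeg_prefix (x : ℕ → Fin q) {k l : ℕ} (h : k ≤ l) : initSeg x k <+: initSeg x l := by
  induction l, h using Nat.le_induction with
  | base => exact List.prefix_refl _
  | succ l _ ih =>
    rw [initSeg_succ]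
    exact ih.trans (List.prefix_append _ _)

theorem exists_initSeg_eq [NeZero q] (w : List (Fin q)) : ∃ x, initSeg x w.length = w := by
  -- Padding with zeros is arbitrary; only the first `w.length` terms count.
  refine ⟨fun i => w.getD i 0, List.ext_getElem (by simp) fun i h1 h2 => ?_⟩
  simp [initSeg, h2]

theorem isOpen_initSeg_eq (k : ℕ) (S : Set (List (Fin q))) : IsOpen {x | initSeg x k ∈ S} := by
  have hc : Continuous fun x : ℕ → Fin q => fun i : Fin k => x i := by fun_prop
  have : {x | initSeg x k ∈ S} =
      (fun x : ℕ → Fin q => fun i : Fin k => x i) ⁻¹' {y | List.ofFn y ∈ S} := by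
    ext x
    have : initSeg x k = List.ofFn fun i : Fin k => x i := by
      refine List.ext_getElem (by simp) fun i h1 h2 => ?_
      simp [initSeg]
    simp [this]
  rw [this]
  exact (isOpen_discrete _).preimage hc

/-- The set of all ends of the tree that meet `S`. -/
def endsOf (S : Set (List (Fin q))) : Set (ℕ → Fin q) := {x | ∃ k, initSeg x k ∈ S}

theorem isOpen_endsOf (S : Set (List (Fin q))) : IsOpen (endsOf S) := by
  have : endsOf S = ⋃ k, {x | initSeg x k ∈ S} := by
    ext x
    simp [endsOf]
  rw [this]
  exact isOpen_iUnion fun k => isOpen_initSeg_eq k S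

/-- The ends in `S` by level k form an increasing open cover of a compact set, so a single level N
captures them all. A longer word in `S` extends to an end, so its prefix of length N is already in
`S`; words of length at most N therefore generate. -/
theorem finGen_of_isClosed_endsOf [NeZero q] {S : Set (List (Fin q))}
    (hS : DescClosed (tree q) S) (hc : IsClosed (endsOf S)) : FinGen (tree q) S := by
  have hmono : ∀ (x : ℕ → Fin q) {k l : ℕ}, k ≤ l → initSeg x k ∈ S → initSeg x l ∈ S := by
    intro x k l hkl hk
    refine hS _ hk ?_
    rw [desc_tree]
    exact initSeg_prefix x hkl
  obtain ⟨N, hN⟩ := hc.isCompact.elim_directed_cover (fun k => {x | initSeg x k ∈ S})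
    (fun k => isOpen_initSeg_eq k S) (fun x hx => mem_iUnion.2 hx)
    (Monotone.directed_le fun k l hkl x hx => hmono x hkl hx)
  refine ⟨{w ∈ S | w.length ≤ N}, (List.finite_length_le (Fin q) N).subset fun w hw => hw.2, ?_⟩
  refine Subset.antisymm (fun w hw => ?_) (hS.descSet_subset fun w hw => hw.1)
  rcases le_total w.length N with h | h
  · exact subset_descSet _ _ ⟨hw, h⟩
  · obtain ⟨x, hx⟩ := exists_initSeg_eq w
    refine mem_iUnion₂.2 ⟨initSeg x N, ⟨hN ⟨w.length, by rwa [hx]⟩, by simp⟩, ?_⟩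
    rw [desc_tree, ← hx]
    exact initSeg_prefix x h

/-- Translating the entries of a sequence by the terms of an infinite sequence; this is an
automorphism of the tree. -/
def translate (c : ℕ → Fin q) (w : List (Fin q)) : List (Fin q) := w.mapIdx fun i a => a + c i

theorem translate_append_singleton (c : ℕ → Fin q) (w : List (Fin q)) (i : Fin q) :
    translate c (w ++ [i]) = translate c w ++ [i + c w.length] := by
  simp [translate]

theorem translate_initSeg (c x : ℕ → Fin q) (k : ℕ) :
    translate c (initSeg x k) = initSeg (x + c) k := by
  induction k with
  | zero => rfl
  | succ k ih => rw [initSeg_succ, translate_append_singleton, ih, initSeg_succ, length_initSeg]; rfl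

theorem translate_neg_translate [NeZero q] (c : ℕ → Fin q) (w : List (Fin q)) :
    translate (-c) (translate c w) = w := by
  obtain ⟨x, hx⟩ := exists_initSeg_eq w
  rw [← hx, translate_initSeg, translate_initSeg, add_neg_cancel_right]

theorem embOn_translate [NeZero q] (c : ℕ → Fin q) :
    EmbOn (tree q) (tree q) univ (translate c) := by
  refine ⟨(Function.LeftInverse.injective (translate_neg_translate c)).injOn, fun w _ => ?_⟩
  rw [out_tree, out_tree, ← range_comp]
  have : (translate c ∘ fun i => w ++ [i]) =
      (fun i => translate c w ++ [i]) ∘ Equiv.addRight (c w.length) := by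
    funext i
    exact translate_append_singleton c w i
  rw [this, (Equiv.surjective _).range_comp]

/-- Tree automorphisms thus act on ends by group translation, hence transitively and by
homeomorphisms. -/
theorem endsOf_translate [NeZero q] (c : ℕ → Fin q) (S : Set (List (Fin q))) :
    endsOf (translate c ⁻¹' S) = Homeomorph.addRight c ⁻¹' endsOf S := by
  ext x
  simp [endsOf, translate_initSeg]

end Ends

/-! ### Finite generation of intersections by Baire category -/

/-- In a countable descendant-homogeneous digraph, the descendant sets of two vertices have
finitely generated intersection. -/
theorem DescHomogeneous.finGen_inter {V : Type*} [Countable V] {D : Digraph V} {q : ℕ}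
    (hD : DescHomogeneous D) (hT : HasTreeDesc q D) (hq : 2 ≤ q) (a b : V) :
    FinGen D (desc D a ∩ desc D b) := by
  have : NeZero q := ⟨by omega⟩
  have : Nonempty V := ⟨a⟩
  obtain ⟨e, he, rfl⟩ := hT.exists_embOn b
  have hcl : ∀ v, DescClosed (tree q) (e ⁻¹' desc D v) := by
    refine fun v => descClosed_iff.2 fun w hw => ?_
    rw [← image_subset_iff, ← he.out_eq w (mem_univ w)]
    exact (descClosed_desc D v).out_subset hw
  have hinter : desc D a ∩ desc D (e []) = e '' (e ⁻¹' desc D a) := by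
    rw [image_preimage_eq_inter_range, he.range_tree]
  rw [hinter, finGen_image_iff he]
  refine finGen_of_isClosed_endsOf (hcl a) ?_
  let U : V → Set (ℕ → Fin q) := fun v => endsOf (e ⁻¹' desc D v)
  have hU : ∀ v, IsOpen (U v) := fun v => isOpen_endsOf _
  -- Extend the translation of the tree below `e []` to an automorphism `g` of `D`; then `g a` is
  -- the required vertex.
  have htrans : ∀ c : ℕ → Fin q, ∃ v, Homeomorph.addRight c ⁻¹' U v = U a := by
    intro c
    have h1 := he.invFunOn (descClosed_univ _)
    have h2 := (he.comp (embOn_translate c) (mapsTo_univ _ _)).comp h1 (mapsTo_univ _ _)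
    obtain ⟨g, hg⟩ := hD.exists_extend
      (by rw [image_univ, he.range_tree]; exact finGen_desc D (e [])) h2
    have hge : ∀ w, g (e w) = e (translate c w) := by
      intro w
      rw [hg (mem_image_of_mem e (mem_univ w))]
      simp only [Function.comp_apply]
      rw [he.injOn.leftInvOn_invFunOn (mem_univ w)]
    refine ⟨g a, ?_⟩
    change _ ⁻¹' endsOf _ = endsOf _
    rw [← endsOf_translate]
    congr 1
    ext w
    simp only [mem_preimage]
    rw [(Iso.embOn g).image_desc (descClosed_univ D) (mem_univ a), ← hge,
      g.injective.mem_set_image]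
  -- Frontiers of open sets are closed and nowhere dense, and countability of `V` lets Baire apply.
  have hdense : Dense (⋂ v, (frontier (U v))ᶜ) := by
    refine dense_iInter_of_isOpen (fun v => isClosed_frontier.isOpen_compl) fun v => ?_
    rw [← interior_eq_empty_iff_dense_compl]
    exact interior_frontier (hU v).isClosed_compl |> fun h => by rwa [frontier_compl] at h
  obtain ⟨y, hy⟩ := hdense.nonempty
  have hempty : frontier (U a) = ∅ := by
    refine eq_empty_of_forall_notMem fun x hx => ?_
    -- The translation by `y - x` moves the supposed frontier point `x` to `y`, which lies on no
    -- frontier.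
    obtain ⟨v, hv⟩ := htrans (y - x)
    rw [← hv, ← Homeomorph.preimage_frontier] at hx
    refine mem_iInter.1 hy v ?_
    simpa using hx
  exact (isClopen_iff_frontier_eq_empty.2 hempty).isClosed

/-! ### Tree decompositions and the extension property -/

section Extension

variable {V W X : Type*} {D : Digraph V} {E : Digraph W} {q : ℕ} {n : ℕ∞}

/-- The set of vertices with the same out-neighbours as `a`. -/
def twins (D : Digraph V) (a : V) : Set V := {b | out D b = out D a}

/-- The hereditary properties that define `𝒞ₙ`, without finite generation: descendant sets are
trees with finitely generated pairwise intersections, and there are fewer than `n` vertices with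
any given set of out-neighbours if `n` is finite. -/
structure Sparse (q : ℕ) (n : ℕ∞) (D : Digraph V) : Prop where
  hasTreeDesc : HasTreeDesc q D
  finGen_inter : ∀ a b, FinGen D (desc D a ∩ desc D b)
  twins_le : ∀ a, (twins D a).encard + 1 ≤ n

/-- The properties of `Dₙ` from which its extension property is derived. -/
structure Rich (q : ℕ) (n : ℕ∞) (D : Digraph V) : Prop extends Sparse q n D where
  nonempty : Nonempty V
  homogeneous : DescHomogeneous D
  le_twins : ∀ a, n ≤ (twins D a).encard + 1

theorem EmbOn.twins_eq {f : V → W} {B : Set V} (h : EmbOn D E B f) (hB : DescClosed D B) {a : V}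
    (ha : a ∈ B) : twins E (f a) ∩ f '' B = f '' (twins D a ∩ B) := by
  ext y
  constructor
  · rintro ⟨hy, b, hb, rfl⟩
    refine mem_image_of_mem f ⟨?_, hb⟩
    have hy' : out E (f b) = out E (f a) := hy
    rw [h.out_eq b hb, h.out_eq a ha] at hy'
    exact (h.injOn.image_eq_image_iff (hB.out_subset hb) (hB.out_subset ha)).1 hy'
  · rintro ⟨b, ⟨hba, hb⟩, rfl⟩
    refine ⟨?_, mem_image_of_mem f hb⟩
    change out E (f b) = out E (f a)
    rw [h.out_eq b hb, h.out_eq a ha, show out D b = out D a from hba]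

theorem Iso.encard_twins (g : Iso D E) (a : V) : (twins E (g a)).encard = (twins D a).encard := by
  have h := (Iso.embOn g).twins_eq (descClosed_univ D) (mem_univ a)
  rw [image_univ, g.surjective.range_eq, inter_univ, inter_univ] at h
  rw [h, g.injective.encard_image]

theorem EmbOn.encard_twins_le {f : V → W} (h : EmbOn D E univ f) (a : V) :
    (twins D a).encard ≤ (twins E (f a)).encard := by
  have := h.twins_eq (descClosed_univ D) (mem_univ a)
  rw [inter_univ] at this
  rw [← h.injective.encard_image, ← this]
  exact encard_le_encard inter_subset_left

theorem Sparse.of_embOn (hE : Sparse q n E) {f : V → W} (h : EmbOn D E univ f) :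
    Sparse q n D := by
  refine ⟨hE.hasTreeDesc.of_embOn h, fun a b => ?_,
    fun a => (add_le_add_left (h.encard_twins_le a) 1).trans (hE.twins_le (f a))⟩
  have := hE.finGen_inter (f a) (f b)
  rwa [h.image_desc (descClosed_univ D) (mem_univ a), h.image_desc (descClosed_univ D) (mem_univ b),
    ← image_inter h.injective, finGen_image_iff h] at this

theorem Sparse.finGen_desc_inter (hD : Sparse q n D) (a : V) {B : Set V} (hB : FinGen D B) :
    FinGen D (desc D a ∩ B) := by
  obtain ⟨Y, hY, rfl⟩ := hB
  rw [descSet, inter_iUnion₂]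
  exact finGen_biUnion Y hY _ fun y _ => hD.finGen_inter a y

/-- Each generating tree contains at most one member of a twin class. -/
theorem HasTreeDesc.finite_twins_inter (hD : HasTreeDesc q D) (hq : 2 ≤ q) (a : V) {B : Set V}
    (hB : FinGen D B) : (twins D a ∩ B).Finite := by
  obtain ⟨Y, hY, rfl⟩ := hB
  rw [descSet, inter_iUnion₂]
  refine hY.biUnion fun y _ => Set.Subsingleton.finite ?_
  rintro s ⟨hs, hsy⟩ t ⟨ht, hty⟩
  exact hD.eq_of_out_eq hq hsy hty ((show out D s = out D a from hs).trans
    (show out D t = out D a from ht).symm)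

/-- For a finitely generated set `B`, every vertex that is far enough below a given vertex is in `B`
or has all its descendants outside `B`. -/
theorem Sparse.exists_depth (hD : Sparse q n D) {e : List (Fin q) → V}
    (he : EmbOn (tree q) D univ e) {B : Set V} (hB : FinGen D B) :
    ∃ k, ∀ x : List (Fin q), x.length = k → e x ∈ B ∨ Disjoint (desc D (e x)) B := by
  obtain ⟨Y, hY, hYB⟩ := hD.finGen_desc_inter (e []) hB
  have hYs : Y ⊆ desc D (e []) ∩ B := hYB ▸ subset_descSet D Y
  have hfin : (e ⁻¹' Y).Finite := hY.preimage he.injective.injOn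
  obtain ⟨k, hk⟩ := (hfin.image List.length).bddAbove
  -- Here `k` bounds the lengths of the generators of the intersection. If the tree below `x` meets
  -- `B`, the common point lies below a generator `u` no longer than `x`; both are prefixes of one
  -- word, so `x` lies below `u`.
  refine ⟨k, fun x hx => or_iff_not_imp_right.2 fun hnd => ?_⟩
  obtain ⟨z, hzx, hzB⟩ := not_disjoint_iff.1 hnd
  rw [he.desc_tree] at hzx
  obtain ⟨t, hxt, rfl⟩ := hzx
  have hz : e t ∈ descSet D Y := hYB ▸ ⟨he.range_tree ▸ mem_range_self t, hzB⟩
  obtain ⟨y, hy, hty⟩ := mem_iUnion₂.1 hz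
  have hyr : y ∈ range e := he.range_tree ▸ (hYs hy).1
  obtain ⟨u, rfl⟩ := hyr
  rw [he.desc_tree, he.injective.mem_set_image] at hty
  have hu : u.length ≤ k := hk (mem_image_of_mem _ hy)
  refine hB.descClosed _ (hYs hy).2 ?_
  rw [he.desc_tree]
  exact mem_image_of_mem e (List.prefix_of_prefix_length_le hty hxt (hx ▸ hu))

/-- Trees at depth `k` that miss `B` are added whole, and then each vertex above them is added once
its children are present. Sibling subtrees are disjoint, so adding one keeps the dichotomy valid for
the next. -/
theorem desc_induction_aux {e : List (Fin q) → V} (he : EmbOn (tree q) D univ e)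
    {P : Set V → Prop}
    (disj : ∀ B w, FinGen D B → P B → Disjoint (desc D w) B → P (B ∪ desc D w))
    (vert : ∀ B w, FinGen D B → P B → w ∉ B → out D w ⊆ B → P (insert w B)) (k : ℕ) :
    ∀ (v : List (Fin q)) (B : Set V), FinGen D B → P B →
      (∀ x : List (Fin q), x.length = k → e (v ++ x) ∈ B ∨ Disjoint (desc D (e (v ++ x))) B) →
      P (B ∪ desc D (e v)) := by
  induction k with
  | zero =>
    intro v B hB hP h
    rcases h [] rfl with h | h
    · rw [List.append_nil] at h
      rwa [union_eq_left.2 (hB.descClosed _ h)]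
    · rw [List.append_nil] at h
      exact disj B _ hB hP h
  | succ k ih =>
    intro v B hB hP h
    by_cases hv : e v ∈ B
    · rwa [union_eq_left.2 (hB.descClosed _ hv)]
    have key : ∀ s : Finset (Fin q), FinGen D (B ∪ ⋃ i ∈ s, desc D (e (v ++ [i]))) ∧
        P (B ∪ ⋃ i ∈ s, desc D (e (v ++ [i]))) := by
      intro s
      induction s using Finset.induction_on with
      | empty => simpa using ⟨hB, hP⟩
      | insert i s his ihs =>
        rw [Finset.set_biUnion_insert, union_comm (desc D (e (v ++ [i]))), ← union_assoc]
        refine ⟨ihs.1.union (finGen_desc D _), ih _ _ ihs.1 ihs.2 fun x hx => ?_⟩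
        rw [List.append_assoc]
        refine (h ([i] ++ x) (by simp [hx])).imp (fun h => Or.inl h) fun h => ?_
        rw [disjoint_union_right]
        refine ⟨h, disjoint_iUnion₂_right.2 fun j hj => ?_⟩
        refine (HasTreeDesc.disjoint_children he v (ne_of_mem_of_not_mem hj his).symm).mono_left ?_
        rw [← List.append_assoc, he.desc_tree, he.desc_tree]
        exact image_mono fun y hy => (List.prefix_append _ _).trans hy
    obtain ⟨h1, h2⟩ := key Finset.univ
    have hun : ⋃ i ∈ (Finset.univ : Finset (Fin q)), desc D (e (v ++ [i])) =
        descSet D (out D (e v)) := by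
      rw [he.out_tree, descSet, biUnion_range]
      simp
    rw [hun] at h1 h2
    rw [desc_eq_insert, union_insert]
    by_cases hv' : e v ∈ B ∪ descSet D (out D (e v))
    · rwa [insert_eq_of_mem hv']
    · exact vert _ _ h1 h2 hv' ((subset_descSet D _).trans subset_union_right)

/-- Every finitely generated set can be enlarged by the descendants of a vertex by successively
adding disjoint trees and single vertices. -/
theorem Sparse.desc_induction (hD : Sparse q n D) {P : Set V → Prop}
    (disj : ∀ B w, FinGen D B → P B → Disjoint (desc D w) B → P (B ∪ desc D w))
    (vert : ∀ B w, FinGen D B → P B → w ∉ B → out D w ⊆ B → P (insert w B))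
    {B : Set V} (hB : FinGen D B) (hP : P B) (a : V) : P (B ∪ desc D a) := by
  obtain ⟨e, he, rfl⟩ := hD.hasTreeDesc.exists_embOn a
  obtain ⟨k, hk⟩ := hD.exists_depth he hB
  exact desc_induction_aux he disj vert k [] B hB hP hk

theorem Sparse.finGen_induction (hD : Sparse q n D) {P : Set V → Prop} (empty : P ∅)
    (disj : ∀ B w, FinGen D B → P B → Disjoint (desc D w) B → P (B ∪ desc D w))
    (vert : ∀ B w, FinGen D B → P B → w ∉ B → out D w ⊆ B → P (insert w B))
    {B : Set V} (hB : FinGen D B) : P B := by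
  obtain ⟨Y, hY, rfl⟩ := hB
  induction Y, hY using Set.Finite.induction_on with
  | empty => rwa [descSet, biUnion_empty]
  | insert _ hY ih =>
    rw [descSet_insert, union_comm]
    exact hD.desc_induction disj vert (finGen_descSet hY) ih _

/-- A finitely generated set is a disjoint union of finitely many trees, up to finitely many
vertices. -/
theorem Sparse.exists_trees (hD : Sparse q n D) {B : Set V} (hB : FinGen D B) :
    ∃ Y : Set V, Y.Finite ∧ Y ⊆ B ∧ Y.PairwiseDisjoint (desc D) ∧ (B \ descSet D Y).Finite := by
  refine hD.finGen_induction (P := fun B => ∃ Y : Set V, Y.Finite ∧ Y ⊆ B ∧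
    Y.PairwiseDisjoint (desc D) ∧ (B \ descSet D Y).Finite) ?_ ?_ ?_ hB
  · exact ⟨∅, finite_empty, Subset.rfl, pairwiseDisjoint_empty, by simp⟩
  · rintro B w hB ⟨Y, hY, hYB, hdis, hfin⟩ hw
    refine ⟨insert w Y, hY.insert w, ?_, ?_, hfin.subset ?_⟩
    · exact insert_subset (Or.inr (mem_desc_self D w)) (hYB.trans subset_union_left)
    · exact hdis.insert fun y hy _ => hw.mono_right (hB.descClosed y (hYB hy))
    · rw [descSet_insert]
      rintro x ⟨hx | hx, hxn⟩
      · exact ⟨hx, fun h => hxn (Or.inr h)⟩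
      · exact absurd (Or.inl hx) hxn
  · rintro B w - ⟨Y, hY, hYB, hdis, hfin⟩ - -
    exact ⟨Y, hY, hYB.trans (subset_insert _ _), hdis, (hfin.insert w).subset
      fun x hx => hx.1.imp id fun h => ⟨h, hx.2⟩⟩

/-- Of two disjoint subtrees, at least one avoids any given vertex; descend once for each element of
`S`. -/
theorem HasTreeDesc.exists_disjoint_finite (hT : HasTreeDesc q D) (hq : 2 ≤ q) (a : V) {S : Set V}
    (hS : S.Finite) : ∃ b ∈ desc D a, Disjoint (desc D b) S := by
  induction S, hS using Set.Finite.induction_on with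
  | empty => exact ⟨a, mem_desc_self D a, disjoint_empty _⟩
  | @insert x S _ _ ih =>
    obtain ⟨b, hb, hbS⟩ := ih
    obtain ⟨c, hc, d, hd, hcd⟩ := hT.exists_disjoint_children hq b
    have hc' := desc_subset_of_mem hc
    have hd' := desc_subset_of_mem hd
    by_cases hx : x ∈ desc D c
    · refine ⟨d, desc_subset_of_mem hb hd, ?_⟩
      rw [disjoint_insert_right]
      exact ⟨disjoint_left.1 hcd hx, hbS.mono_left hd'⟩
    · refine ⟨c, desc_subset_of_mem hb hc, ?_⟩
      rw [disjoint_insert_right]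
      exact ⟨hx, hbS.mono_left hc'⟩

/-- A spare tree is carried through the induction: of two disjoint subtrees in it, one receives the
next tree and the other is the new spare. -/
theorem HasTreeDesc.exists_embOn_trees (hT : HasTreeDesc q D) (hE : HasTreeDesc q E) (hq : 2 ≤ q)
    [Nonempty W] {Y : Set V} (hY : Y.Finite) (hdis : Y.PairwiseDisjoint (desc D)) :
    ∃ f b, EmbOn D E (descSet D Y) f ∧ Disjoint (f '' descSet D Y) (desc E b) := by
  induction Y, hY using Set.Finite.induction_on with
  | empty =>
    obtain ⟨b⟩ := ‹Nonempty W›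
    rw [descSet, biUnion_empty]
    exact ⟨fun _ => b, b, ⟨injOn_empty _, fun a h => h.elim⟩, by simp⟩
  | @insert y Y hy _ ih =>
    obtain ⟨f, b, hf, hb⟩ := ih (hdis.subset (subset_insert y Y))
    obtain ⟨c, hc, d, hd, hcd⟩ := hE.exists_disjoint_children hq b
    have hc' := desc_subset_of_mem hc
    have hd' := desc_subset_of_mem hd
    obtain ⟨g, hg, rfl⟩ := exists_embOn_desc hT hE y c
    have hgi := hg.image_desc (descClosed_desc D y) (mem_desc_self D y)
    have hyY : Disjoint (descSet D Y) (desc D y) := by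
      refine disjoint_iUnion₂_left.2 fun z hz => ?_
      exact hdis (mem_insert_of_mem y hz) (mem_insert y Y) (ne_of_mem_of_not_mem hz hy)
    obtain ⟨k, hk, hkf, hkg⟩ := hf.exists_union hg (descClosed_descSet D Y) (descClosed_desc D y)
      hyY (by rw [← hgi]; exact hb.mono_right hc')
    refine ⟨k, d, ?_, ?_⟩
    · rwa [descSet_insert, union_comm]
    · rw [descSet_insert, image_union, ← image_congr hkf, ← image_congr hkg, ← hgi,
        disjoint_union_left]
      exact ⟨hcd, hb.mono_right hd'⟩

/-- Up to finitely many vertices, `B` is a disjoint union of trees. These can be re-embedded to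
leave a free tree, which an extending automorphism pulls back; descending inside it avoids the
finite remainder. -/
theorem Rich.exists_disjoint (hD : Rich q n D) (hq : 2 ≤ q) {B : Set V} (hB : FinGen D B) :
    ∃ a, Disjoint (desc D a) B := by
  have := hD.nonempty
  obtain ⟨Y, hY, -, hdis, hfin⟩ := hD.exists_trees hB
  obtain ⟨f, b, hf, hb⟩ := hD.hasTreeDesc.exists_embOn_trees hD.hasTreeDesc hq hY hdis
  obtain ⟨g, hg⟩ := hD.homogeneous.exists_extend (finGen_descSet hY) hf
  obtain ⟨a, rfl⟩ := g.surjective b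
  rw [(Iso.embOn g).image_desc (descClosed_univ D) (mem_univ a), ← image_congr hg,
    disjoint_image_iff g.injective] at hb
  obtain ⟨c, hc, hcS⟩ := hD.hasTreeDesc.exists_disjoint_finite hq a hfin
  refine ⟨c, disjoint_left.2 fun x hx hxB => ?_⟩
  refine disjoint_left.1 hcS hx ⟨hxB, fun hxY => ?_⟩
  exact disjoint_left.1 hb hxY (desc_subset_of_mem hc hx)

/-- In a rich digraph, the image of an out-neighbourhood under an embedding of a finitely generated
set is the out-neighbourhood of a vertex outside the image. -/
theorem Rich.exists_parent (hE : Rich q n E) (hD : Sparse q n D) (hq : 2 ≤ q) {B : Set V}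
    (hB : FinGen D B) {f : V → W} (hf : EmbOn D E B f) {w : V} (hw : w ∉ B) (hwB : out D w ⊆ B) :
    ∃ w', w' ∉ f '' B ∧ out E w' = f '' out D w := by
  obtain ⟨d⟩ := hE.nonempty
  obtain ⟨h, hh, rfl⟩ := exists_embOn_desc hE.hasTreeDesc hD.hasTreeDesc d w
  have hout : out D (h d) = h '' out E d := hh.out_eq d (mem_desc_self E d)
  have hsub : descSet E (out E d) ⊆ desc E d := by
    rw [desc_eq_insert]
    exact subset_insert _ _
  have hm : MapsTo h (descSet E (out E d)) B := by
    rw [mapsTo_iff_image_subset,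
      ← hh.image_descSet (descClosed_desc E d) (out_subset_desc E d), ← hout]
    exact hB.descClosed.descSet_subset hwB
  -- The proper descendants of `d` are carried onto those of `w` and then into `E` by `f`. The
  -- extension `g` makes `g d` a vertex with the right out-neighbours, though possibly inside the
  -- image of `f`.
  obtain ⟨g, hg⟩ := hE.homogeneous.exists_extend
    (finGen_descSet (hE.hasTreeDesc.finite_out d)) (hf.comp (hh.mono hsub) hm)
  have hgd : out E (g d) = f '' out D (h d) := by
    rw [(Iso.embOn g).out_eq d (mem_univ d), hout, ← image_comp]
    exact image_congr (hg.mono (subset_descSet E _))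
  by_contra! hcon
  -- If no vertex outside worked, all twins of `g d` would come from twins of `h d` in `B`. These
  -- are finitely many and omit `h d` itself, so they are too few for the twin count of `E`.
  have htw : twins E (g d) ⊆ f '' (twins D (h d) ∩ B) := by
    intro x hx
    have hxo : out E x = f '' out D (h d) := (show out E x = out E (g d) from hx).trans hgd
    have hxB : x ∈ f '' B := by_contra fun hxB => hcon x hxB hxo
    obtain ⟨b, hb, rfl⟩ := hxB
    rw [hf.out_eq b hb] at hxo
    exact mem_image_of_mem f ⟨(hf.injOn.image_eq_image_iff (hB.descClosed.out_subset hb) hwB).1 hxo,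
      hb⟩
  have hfin := hD.hasTreeDesc.finite_twins_inter hq (h d) hB
  have h1 : (twins E (g d)).encard ≤ (twins D (h d) ∩ B).encard :=
    (encard_le_encard htw).trans (encard_image_le _ _)
  have h2 : (twins D (h d) ∩ B).encard + 1 ≤ (twins D (h d)).encard := by
    rw [← encard_insert_of_notMem (fun hmem => hw hmem.2)]
    exact encard_le_encard (insert_subset rfl inter_subset_left)
  have h3 : n ≤ (twins D (h d) ∩ B).encard + 1 := (hE.le_twins (g d)).trans (add_le_add_left h1 1)
  have h4 := (add_le_add_left (h3.trans h2) 1).trans (hD.twins_le (h d))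
  obtain ⟨m, hm⟩ := ENat.ne_top_iff_exists.1 hfin.encard_lt_top.ne
  rw [← hm] at h3
  have hn : n ≠ ⊤ := ne_top_of_le_ne_top (by exact_mod_cast ENat.natCast_ne_top (m + 1)) h3
  obtain ⟨l, rfl⟩ := ENat.ne_top_iff_exists.1 hn
  have : l + 1 ≤ l := by exact_mod_cast h4
  omega

/-- The extension property. -/
theorem Rich.exists_extend (hE : Rich q n E) (hD : Sparse q n D) (hq : 2 ≤ q) {B : Set V}
    (hB : FinGen D B) {f : V → W} (hf : EmbOn D E B f) (a : V) :
    ∃ k, EmbOn D E (B ∪ desc D a) k ∧ EqOn k f B := by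
  refine (hD.desc_induction (P := fun C => B ⊆ C ∧ ∃ k, EmbOn D E C k ∧ EqOn k f B)
    ?_ ?_ hB ⟨Subset.rfl, f, hf, fun _ _ => rfl⟩ a).2
  · rintro C w hC ⟨hBC, k, hk, hkf⟩ hdis
    refine ⟨hBC.trans subset_union_left, ?_⟩
    obtain ⟨b, hb⟩ := hE.exists_disjoint hq (hk.finGen_image hC.descClosed hC Subset.rfl)
    obtain ⟨g, hg, rfl⟩ := exists_embOn_desc hD.hasTreeDesc hE.hasTreeDesc w b
    rw [hg.image_desc (descClosed_desc D w) (mem_desc_self D w)] at hb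
    obtain ⟨l, hl, hlk, -⟩ := hk.exists_union hg hC.descClosed (descClosed_desc D w) hdis.symm
      hb.symm
    exact ⟨l, hl, (hlk.symm.mono hBC).trans hkf⟩
  · rintro C w hC ⟨hBC, k, hk, hkf⟩ hw hwC
    refine ⟨hBC.trans (subset_insert w C), ?_⟩
    obtain ⟨w', hw', ho⟩ := hE.exists_parent hD hq hC hk hw hwC
    obtain ⟨l, hl, hlk, -⟩ := hk.exists_insert hC.descClosed hw hwC hw' ho
    exact ⟨l, hl, (hlk.symm.mono hBC).trans hkf⟩

theorem Rich.exists_embOn_descSet (hE : Rich q n E) (hD : Sparse q n D) (hq : 2 ≤ q) {Y : Set V}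
    (hY : Y.Finite) : ∃ k, EmbOn D E (descSet D Y) k := by
  induction Y, hY using Set.Finite.induction_on with
  | empty =>
    obtain ⟨b⟩ := hE.nonempty
    rw [descSet, biUnion_empty]
    exact ⟨fun _ => b, ⟨injOn_empty _, fun a h => h.elim⟩⟩
  | @insert y Y hy hY ih =>
    obtain ⟨f, hf⟩ := ih
    obtain ⟨k, hk, -⟩ := hE.exists_extend hD hq (finGen_descSet hY) hf y
    rw [descSet_insert, union_comm]
    exact ⟨k, hk⟩

end Extension

/-! ### Back-and-forth -/

section BackAndForth

variable {V W : Type*} {D : Digraph V} {E : Digraph W} {q : ℕ} {n : ℕ∞}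

/-- The "back" step: extend the inverse of `f` with the roles of `D` and `E` exchanged, then invert
again. -/
theorem Rich.exists_extend_surj (hD : Rich q n D) (hE : Rich q n E) (hq : 2 ≤ q) {B : Set V}
    (hB : FinGen D B) {f : V → W} (hf : EmbOn D E B f) (b : W) :
    ∃ C k, FinGen D C ∧ EmbOn D E C k ∧ B ⊆ C ∧ EqOn k f B ∧ b ∈ k '' C := by
  have := hD.nonempty
  have := hE.nonempty
  have hBc := hB.descClosed
  have hfB := hf.finGen_image hBc hB Subset.rfl
  obtain ⟨g, hg, hgf⟩ := hD.exists_extend hE.toSparse hq hfB (hf.invFunOn hBc) b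
  have hC : FinGen E (f '' B ∪ desc E b) := hfB.union (finGen_desc E b)
  have hgB : ∀ x ∈ B, g (f x) = x := fun x hx => by
    rw [hgf (mem_image_of_mem f hx), hf.injOn.leftInvOn_invFunOn hx]
  refine ⟨_, _, hg.finGen_image hC.descClosed hC Subset.rfl, hg.invFunOn hC.descClosed, ?_, ?_, ?_⟩
  · exact fun x hx => ⟨f x, Or.inl (mem_image_of_mem f hx), hgB x hx⟩
  · intro x hx
    have := hg.injOn.leftInvOn_invFunOn (Or.inl (mem_image_of_mem f hx))
    rwa [hgB x hx] at this
  · have hb : b ∈ f '' B ∪ desc E b := Or.inr (mem_desc_self E b)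
    exact ⟨g b, mem_image_of_mem g hb, hg.injOn.leftInvOn_invFunOn hb⟩

/-- Countable rich digraphs with the same parameters are isomorphic. -/
theorem Rich.nonempty_iso [Countable V] [Countable W] (hD : Rich q n D) (hE : Rich q n E)
    (hq : 2 ≤ q) : Nonempty (Iso D E) := by
  have := hD.nonempty
  have := hE.nonempty
  obtain ⟨a, ha⟩ := exists_surjective_nat V
  obtain ⟨b, hb⟩ := exists_surjective_nat W
  let S := {p : Set V × (V → W) // FinGen D p.1 ∧ EmbOn D E p.1 p.2}
  have hstep : ∀ (k : ℕ) (p : S), ∃ p' : S, p.1.1 ⊆ p'.1.1 ∧ EqOn p'.1.2 p.1.2 p.1.1 ∧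
      a k ∈ p'.1.1 ∧ b k ∈ p'.1.2 '' p'.1.1 := by
    rintro k ⟨⟨B, f⟩, hB, hf⟩
    obtain ⟨g, hg, hgf⟩ := hE.exists_extend hD.toSparse hq hB hf (a k)
    obtain ⟨C, h, hC, hh, hBC, hhg, hbk⟩ :=
      hD.exists_extend_surj hE hq (hB.union (finGen_desc D (a k))) hg (b k)
    refine ⟨⟨⟨C, h⟩, hC, hh⟩, subset_union_left.trans hBC, ?_, ?_, hbk⟩
    · exact (hhg.mono subset_union_left).trans hgf
    · exact hBC (Or.inr (mem_desc_self D (a k)))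
  choose step hsub heq hak hbk using hstep
  let p₀ : S := ⟨⟨∅, fun _ => b 0⟩, finGen_empty D, ⟨injOn_empty _, fun a h => h.elim⟩⟩
  let p : ℕ → S := fun k => Nat.rec p₀ step k
  have hle : ∀ {k l : ℕ}, k ≤ l → (p k).1.1 ⊆ (p l).1.1 ∧ EqOn (p l).1.2 (p k).1.2 (p k).1.1 := by
    intro k l hkl
    induction l, hkl using Nat.le_induction with
    | base => exact ⟨Subset.rfl, fun _ _ => rfl⟩
    | succ l _ ih =>
      exact ⟨ih.1.trans (hsub l (p l)), ((heq l (p l)).mono ih.1).trans ih.2⟩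
  have hex : ∀ x, ∃ k, x ∈ (p k).1.1 := by
    intro x
    obtain ⟨k, rfl⟩ := ha x
    exact ⟨k + 1, hak k (p k)⟩
  -- The limit map evaluates `x` at any stage whose domain contains it; the stages are coherent, so
  -- the choice is immaterial.
  choose κ hκ using hex
  have hF : ∀ k, EqOn (p k).1.2 (fun x => (p (κ x)).1.2 x) (p k).1.1 := by
    intro k x hx
    rcases le_total k (κ x) with h | h
    · exact ((hle h).2 hx).symm
    · exact (hle h).2 (hκ x)
  have hemb : ∀ k, EmbOn D E (p k).1.1 (fun x => (p (κ x)).1.2 x) :=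
    fun k => (p k).2.2.congr (p k).2.1.descClosed (hF k)
  have hall : EmbOn D E univ (fun x => (p (κ x)).1.2 x) := by
    refine ⟨fun x _ y _ hxy => ?_, fun x _ => (hemb (κ x)).out_eq x (hκ x)⟩
    exact (hemb (max (κ x) (κ y))).injOn ((hle (le_max_left _ _)).1 (hκ x))
      ((hle (le_max_right _ _)).1 (hκ y)) hxy
  obtain ⟨g, -⟩ := hall.exists_iso fun y => by
    obtain ⟨k, rfl⟩ := hb y
    obtain ⟨x, hx, hxy⟩ := hbk k (p k)
    exact ⟨x, ((hF (k + 1)) hx).symm.trans hxy⟩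
  exact ⟨g⟩

end BackAndForth

/-! ### Twin counts, the class `𝒞ₙ` and its limits -/

section MultiTree

variable {V W : Type*} {D : Digraph V} {E : Digraph W} {q : ℕ} {n : ℕ∞}

theorem le_encard_twins_multiTree (q : ℕ) {m : ℕ} (i : Fin m) :
    (m : ℕ∞) ≤ (twins (multiTree q m) (Sum.inl i)).encard := by
  have h : range (Sum.inl : Fin m → Fin m ⊕ {w : List (Fin q) // w ≠ []}) ⊆
      twins (multiTree q m) (Sum.inl i) := by
    rintro _ ⟨j, rfl⟩
    ext (x | x) <;> rfl
  refine le_trans ?_ (encard_le_encard h)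
  rw [← image_univ, Sum.inl_injective.encard_image, encard_univ]
  simp

theorem HasTreeDesc.descEmbeds_multiTree (hT : HasTreeDesc q E) {d : W} {m : ℕ}
    (h : (m : ℕ∞) ≤ (twins E d).encard) : DescEmbeds (multiTree q m) E := by
  obtain ⟨t, ht, htm⟩ := exists_subset_encard_eq h
  have htf : t.Finite := finite_of_encard_eq_coe htm
  have : Fintype t := htf.fintype
  have hcard : Fintype.card t = m := by
    rw [← coe_fintypeCard] at htm
    exact_mod_cast htm
  let r : Fin m ≃ t := (Fintype.equivFinOfCardEq hcard).symm
  have hr : ∀ i, out E (r i : W) = out E d := fun i => ht (r i).2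
  obtain ⟨e, he, rfl⟩ := hT.exists_embOn d
  let f : Fin m ⊕ {w : List (Fin q) // w ≠ []} → W := Sum.elim (fun i => r i) (fun w => e w)
  -- A chosen twin below the children of `e []` would be below its own children, since these are the
  -- same.
  have hne : ∀ (i : Fin m) (w : {w : List (Fin q) // w ≠ []}), (r i : W) ≠ e w := by
    intro i w hiw
    have h1 : e w ∈ desc E (e []) := he.range_tree ▸ mem_range_self _
    rw [desc_eq_insert] at h1
    rcases h1 with h1 | h1
    · exact w.2 (he.injective h1)
    · rw [← hr i, ← hiw] at h1
      exact hT.not_mem_descSet_out _ h1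
  refine EmbOn.descEmbeds (f := f) ⟨?_, ?_⟩
  · rintro (i | w) - (j | x) - hij
    · exact congrArg _ (r.injective (Subtype.ext hij))
    · exact (hne i x hij).elim
    · exact (hne j w hij.symm).elim
    · exact congrArg _ (Subtype.ext (he.injective hij))
  · rintro (i | w) -
    · change out E (r i) = _
      rw [hr, he.out_tree]
      ext y
      constructor
      · rintro ⟨j, rfl⟩
        exact ⟨Sum.inr ⟨[] ++ [j], by simp⟩, ⟨j, rfl⟩, rfl⟩
      · rintro ⟨j | ⟨x, hx⟩, hxo, rfl⟩
        · exact hxo.elim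
        · obtain ⟨j, rfl⟩ := hxo
          exact ⟨j, rfl⟩
    · change out E (e w) = _
      rw [he.out_tree]
      ext y
      constructor
      · rintro ⟨j, rfl⟩
        exact ⟨Sum.inr ⟨w ++ [j], by simp⟩, ⟨j, rfl⟩, rfl⟩
      · rintro ⟨j | ⟨x, hx⟩, hxo, rfl⟩
        · exact hxo.elim
        · obtain ⟨j, rfl⟩ := hxo
          exact ⟨j, rfl⟩

/-- The roots of `𝒯ₘ` are m twins, and conversely m twins together with their common proper
descendants form a copy of `𝒯ₘ`. For `n = ⊤` neither side restricts twins. -/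
theorem classCn_iff (hn : 2 ≤ n) {V : Type u} {A : Digraph V} :
    ClassCn q n V A ↔ Sparse q n A ∧ FinGen A univ := by
  constructor
  · rintro ⟨⟨hT, hfg, hI⟩, hm⟩
    refine ⟨⟨hT, hI, fun a => ?_⟩, hfg⟩
    by_contra! hlt
    obtain ⟨m, rfl⟩ := ENat.ne_top_iff_exists.1 hlt.ne_top
    exact hm m rfl (hT.descEmbeds_multiTree (Order.le_of_lt_add_one hlt))
  · rintro ⟨hS, hfg⟩
    refine ⟨⟨hS.hasTreeDesc, hfg, hS.finGen_inter⟩, ?_⟩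
    rintro m rfl ⟨f, hf⟩
    have hm : 2 ≤ m := by exact_mod_cast hn
    have h1 := (le_encard_twins_multiTree q (⟨0, by omega⟩ : Fin m)).trans
      ((Embedding.embOn f hf).encard_twins_le _)
    have h2 := (add_le_add_left h1 1).trans (hS.twins_le _)
    have : m + 1 ≤ m := by exact_mod_cast h2
    omega

theorem Rich.isFraisseLimit {V : Type u} [Countable V] {D : Digraph V} (hD : Rich q n D)
    (hq : 2 ≤ q) (hn : 2 ≤ n) : IsFraisseLimit (ClassCn q n) D := by
  refine ⟨inferInstance, hD.homogeneous, fun W A => ?_⟩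
  rw [classCn_iff hn]
  constructor
  · rintro ⟨hA, hfg⟩
    have hfg' := hfg
    obtain ⟨Y, hY, hYu⟩ := hfg'
    obtain ⟨k, hk⟩ := hD.exists_embOn_descSet hA hq hY
    rw [← hYu] at hk
    refine ⟨range k, ?_, ⟨hk.isoRange⟩⟩
    rw [← image_univ]
    exact (finGen_image_iff hk).2 hfg
  · rintro ⟨S, hS, ⟨g⟩⟩
    have h := (embOn_val hS.descClosed).comp (Iso.embOn g) (mapsTo_univ _ _)
    refine ⟨hD.toSparse.of_embOn h, (finGen_image_iff h).1 ?_⟩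
    rwa [image_univ, g.surjective.range_comp, Subtype.range_val]

theorem HasTreeDesc.exists_iso_apply_eq (hT : HasTreeDesc q D) (hD : DescHomogeneous D) (a b : V) :
    ∃ g : Iso D D, g a = b := by
  obtain ⟨f, hf, rfl⟩ := exists_embOn_desc hT hT a b
  obtain ⟨g, hg⟩ := hD.exists_extend (finGen_desc D a) hf
  exact ⟨g, hg (mem_desc_self D a)⟩

theorem HasTreeDesc.encard_twins_eq (hT : HasTreeDesc q D) (hD : DescHomogeneous D) (a b : V) :
    (twins D a).encard = (twins D b).encard := by
  obtain ⟨g, rfl⟩ := hT.exists_iso_apply_eq hD a b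
  exact (Iso.encard_twins g a).symm

/-- A digraph is sparse if all its finitely generated subdigraphs are. -/
theorem sparse_of_finGen (hn : 2 ≤ n) (h : ∀ S, FinGen D S → Sparse q n (induce D S)) :
    Sparse q n D := by
  refine ⟨hasTreeDesc_of_embOn fun a => ?_, fun a b => ?_, fun a => ?_⟩
  · obtain ⟨e, he, hea⟩ :=
      (h _ (finGen_desc D a)).hasTreeDesc.exists_embOn ⟨a, mem_desc_self D a⟩
    refine ⟨_, (embOn_val (descClosed_desc D a)).comp he (mapsTo_univ _ _), ?_⟩
    simp [hea]
  · have hS := (finGen_desc D a).union (finGen_desc D b)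
    have hv := embOn_val hS.descClosed
    have h1 := (h _ hS).finGen_inter ⟨a, Or.inl (mem_desc_self D a)⟩ ⟨b, Or.inr (mem_desc_self D b)⟩
    rwa [← finGen_image_iff hv, image_inter hv.injective,
      ← hv.image_desc (descClosed_univ _) (mem_univ _),
      ← hv.image_desc (descClosed_univ _) (mem_univ _)] at h1
  · by_contra! hlt
    obtain ⟨m, rfl⟩ := ENat.ne_top_iff_exists.1 hlt.ne_top
    -- An excess of twins has a finite witness: the set generated by `a` and `m` of its twins
    -- violates the bound already.
    obtain ⟨t, ht, htm⟩ := exists_subset_encard_eq (Order.le_of_lt_add_one hlt)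
    have htf : t.Finite := finite_of_encard_eq_coe htm
    have hS := finGen_descSet (D := D) (htf.insert a)
    have hsub := subset_descSet D (insert a t)
    have hv := embOn_val hS.descClosed
    have h1 := (h _ hS).twins_le ⟨a, hsub (mem_insert a t)⟩
    have h2 := hv.twins_eq (descClosed_univ _) (mem_univ ⟨a, hsub (mem_insert a t)⟩)
    rw [image_univ, Subtype.range_val, inter_univ] at h2
    rw [← hv.injective.encard_image, ← h2] at h1
    have h3 : t.encard ≤ (twins D a ∩ descSet D (insert a t)).encard :=
      encard_le_encard (subset_inter ht ((subset_insert a t).trans hsub))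
    rw [htm] at h3
    have h4 := (add_le_add_left h3 1).trans h1
    have : m + 1 ≤ m := by exact_mod_cast h4
    omega

/-- Sparsity is visible on finitely generated subdigraphs. For the lower bound on twins, `D` is the
witness: a smaller twin class in `M` could not accommodate finitely generated pieces of `D`, all of
which embed in `M`. -/
theorem Rich.of_isFraisseLimit {V : Type u} [Countable V] {D : Digraph V} {W : Type v}
    {M : Digraph W} (hD : Rich q n D) (hq : 2 ≤ q) (hn : 2 ≤ n)
    (hM : IsFraisseLimit (ClassCn q n) M) : Rich q n M := by
  have htransfer : ∀ S, FinGen D S → ∃ f, EmbOn (induce D S) M univ f := by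
    intro S hS
    have hSc := ((hD.isFraisseLimit hq hn).2.2 _ _).2 ⟨S, hS, ⟨RelIso.refl _⟩⟩
    rw [classCn_iff hn] at hSc
    -- `M` tests only digraphs in its own universe, so the countable piece `S` is replaced by a copy
    -- there.
    have : Small.{v} S := Countable.toSmall S
    let A : Digraph (Shrink.{v} S) :=
      ⟨fun a b => (induce D S).Adj ((equivShrink S).symm a) ((equivShrink S).symm b)⟩
    let g : Iso A (induce D S) := ⟨(equivShrink S).symm, Iff.rfl⟩
    have hA : ClassCn q n _ A := by
      refine (classCn_iff hn).2 ⟨hSc.1.of_embOn (Iso.embOn g), ?_⟩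
      rw [← finGen_image_iff (Iso.embOn g), image_univ, g.surjective.range_eq]
      exact hSc.2
    obtain ⟨S', hS', ⟨g'⟩⟩ := (hM.2.2 _ _).1 hA
    exact ⟨_, (embOn_val hS'.descClosed).comp (Iso.embOn (g.symm.trans g')) (mapsTo_univ _ _)⟩
  have hsparse : Sparse q n M := sparse_of_finGen hn fun S hS =>
    ((classCn_iff hn).1 ((hM.2.2 _ _).2 ⟨S, hS, ⟨RelIso.refl _⟩⟩)).1
  obtain ⟨d⟩ := hD.nonempty
  refine ⟨hsparse, ?_, hM.2.1, fun a => ?_⟩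
  · obtain ⟨f, -⟩ := htransfer _ (finGen_desc D d)
    exact ⟨f ⟨d, mem_desc_self D d⟩⟩
  · by_contra! hlt
    -- One twin more than `M` allows is a finite number, so that many twins of `d` generate a piece
    -- of `D` that embeds in `M`.
    have hle : (twins M a).encard + 1 ≤ (twins D d).encard :=
      Order.le_of_lt_add_one (hlt.trans_le (hD.le_twins d))
    obtain ⟨t, ht, htm⟩ := exists_subset_encard_eq hle
    have htf : t.Finite := by
      rw [← encard_lt_top_iff, htm]
      exact hlt.trans_le le_top
    have hS := finGen_descSet (D := D) (htf.insert d)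
    have hsub := subset_descSet D (insert d t)
    obtain ⟨f, hf⟩ := htransfer _ hS
    have hv := embOn_val hS.descClosed
    have h2 := hv.twins_eq (descClosed_univ _) (mem_univ ⟨d, hsub (mem_insert d t)⟩)
    rw [image_univ, Subtype.range_val, inter_univ] at h2
    have h1 := hf.encard_twins_le ⟨d, hsub (mem_insert d t)⟩
    rw [← hv.injective.encard_image, ← h2, hsparse.hasTreeDesc.encard_twins_eq hM.2.1 _ a] at h1
    have h3 : t.encard ≤ (twins D d ∩ descSet D (insert d t)).encard :=
      encard_le_encard (subset_inter ht ((subset_insert d t).trans hsub))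
    rw [htm] at h3
    have h4 := h3.trans h1
    have htop : (twins M a).encard ≠ ⊤ := by
      intro h
      rw [h] at hlt
      simp at hlt
    obtain ⟨m, hm⟩ := ENat.ne_top_iff_exists.1 htop
    rw [← hm] at h4
    have : m + 1 ≤ m := by exact_mod_cast h4
    omega

/-- Vertex-transitivity makes the twin number constant, so both twin bounds are equalities for this
n. -/
theorem DescHomogeneous.rich [Countable V] [Nonempty V] (hD : DescHomogeneous D)
    (hT : HasTreeDesc q D) (hq : 2 ≤ q) (d : V) : Rich q ((twins D d).encard + 1) D where
  hasTreeDesc := hT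
  finGen_inter := hD.finGen_inter hT hq
  twins_le a := by rw [hT.encard_twins_eq hD a d]
  nonempty := inferInstance
  homogeneous := hD
  le_twins a := by rw [hT.encard_twins_eq hD a d]

end MultiTree

end DescDigraph

/-- A nonempty countable descendant-homogeneous digraph whose descendant sets are `q`-valent trees is
the Fraïssé limit of `𝒞ₙ` for some `n`, and every Fraïssé limit of `𝒞ₙ` is isomorphic to it. -/
theorem theorem2p5 (q : ℕ) (hq : 2 ≤ q) {V : Type u} [Countable V] [Nonempty V] (D : Digraph V)
    (hD : DescDigraph.DescHomogeneous D) (hT : DescDigraph.HasTreeDesc q D) :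
    ∃ n : ℕ∞, 2 ≤ n ∧
      DescDigraph.IsFraisseLimit (DescDigraph.ClassCn q n) D ∧
      ∀ (W : Type v) (M : Digraph W),
        DescDigraph.IsFraisseLimit (DescDigraph.ClassCn q n) M →
          Nonempty (DescDigraph.Iso D M) := by
  obtain ⟨d⟩ := ‹Nonempty V›
  have : Nonempty V := ⟨d⟩
  have hR := hD.rich hT hq d
  -- Every vertex is its own twin.
  have hn : 2 ≤ (DescDigraph.twins D d).encard + 1 := by
    have h1 : 1 ≤ (DescDigraph.twins D d).encard := by
      rw [Set.one_le_encard_iff_nonempty]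
      exact ⟨d, rfl⟩
    have := add_le_add_left h1 1
    rwa [one_add_one_eq_two] at this
  refine ⟨_, hn, hR.isFraisseLimit hq hn, fun W M hM => ?_⟩
  have := hM.1
  exact hR.nonempty_iso (hR.of_isFraisseLimit hq hn hM) hq
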